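/- Let $\mathbb K\in\{\mathbb R,\mathbb C\}$, let $X,Y$ be infinite-dimensional Hilbert spaces over $\mathbb K$, and let $A:X\to Y$ be a compact injective bounded linear operator. Let $\sigma_1(A)\ge\sigma_2(A)\ge\dots$ be its singular values, i.e. the square roots of the eigenvalues of $A^*A$ in nonincreasing order, repeated according to multiplicity. Assume that for some $k\in\mathbb N$ one has $\sigma_n(A)\sim n^{-k}$, meaning that there are constants $c,C>0$ with $$ c\,n^{-k}\le\sigma_n(A)\le C\,n^{-k}\qquad\text{for all } n\ge 1 .$$ Let $J:L^2(0,1)\to L^2(0,1)$, $(Jf)(x)=\int_0^x f(t)\,dt$, be the integration operator on the $\mathbb K$-valued space $L^2(0,1)$. Then there are isomorphisms (bounded, linear, bijective, with bounded inverse) $T:X\to L^2(0,1)$ and $S:L^2(0,1)\to\overline{\mathcal R(A)}$, where $\overline{\mathcal R(A)}\subseteq Y$ is the closure of the range of $A$ (so $S$ maps onto $Y$ if $A$ has dense range), such that $$ A=S\,J^k\,T .$$ Moreover, either one of the two operators can be chosen unitary (a surjective linear isometry): there is such a factorization with $S$ unitary and $T$ an isomorphism, and there is one with $T$ unitary and $S$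 an isomorphism. -/

import Mathlib

open MeasureTheory

noncomputable section

/-- The Hilbert space `L²(0,1)` of (real or complex) scalar functions. -/
abbrev L2Unit (𝕜 : Type*) [RCLike 𝕜] : Type _ :=
  Lp 𝕜 2 (volume.restrict (Set.Ioo (0 : ℝ) 1))

theorem L2Unit.integrableOn {𝕜 : Type*} [RCLike 𝕜] (f : L2Unit 𝕜) :
    IntegrableOn (f : ℝ → 𝕜) (Set.Ioo (0 : ℝ) 1) volume :=
  (Lp.memLp f).integrable (by norm_num)

theorem L2Unit.intervalIntegrable {𝕜 : Type*} [RCLike 𝕜] (f : L2Unit 𝕜) {x : ℝ}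
    (h0 : 0 ≤ x) (h1 : x ≤ 1) : IntervalIntegrable (f : ℝ → 𝕜) volume 0 x := by
  rw [intervalIntegrable_iff_integrableOn_Ioo_of_le h0]
  exact f.integrableOn.mono_set (Set.Ioo_subset_Ioo_right h1)

theorem L2Unit.norm_primitive_le {𝕜 : Type*} [RCLike 𝕜] (f : L2Unit 𝕜) {x : ℝ}
    (hx : x ∈ Set.Ioo (0 : ℝ) 1) : ‖∫ t in (0 : ℝ)..x, f t‖ ≤ ‖f‖ := by
  have hsub : Set.Ioc (0 : ℝ) x ⊆ Set.Ioo 0 1 := fun t ht => ⟨ht.1, ht.2.trans_lt hx.2⟩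
  have h1 : ‖∫ t in (0 : ℝ)..x, f t‖ ≤ ∫ t in Set.Ioo (0 : ℝ) 1, ‖f t‖ := by
    rw [intervalIntegral.integral_of_le hx.1.le]
    exact (norm_integral_le_integral_norm _).trans
      (setIntegral_mono_set f.integrableOn.norm
        (Filter.Eventually.of_forall fun _ => norm_nonneg _) hsub.eventuallyLE)
  have h2 : (∫ t in Set.Ioo (0 : ℝ) 1, ‖f t‖) ≤ ‖f‖ := by
    rw [integral_norm_eq_lintegral_enorm (Lp.aestronglyMeasurable f), Lp.norm_def]
    refine ENNReal.toReal_mono (Lp.eLpNorm_ne_top f) ?_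
    rw [← eLpNorm_one_eq_lintegral_enorm]
    have : IsProbabilityMeasure (volume.restrict (Set.Ioo (0 : ℝ) 1)) := ⟨by simp⟩
    exact eLpNorm_le_eLpNorm_of_exponent_le (by norm_num) (Lp.aestronglyMeasurable f)
  exact h1.trans h2

theorem L2Unit.memLp_primitive {𝕜 : Type*} [RCLike 𝕜] (f : L2Unit 𝕜) :
    MemLp (fun x : ℝ => ∫ t in (0 : ℝ)..x, f t) 2 (volume.restrict (Set.Ioo (0 : ℝ) 1)) := by
  have hc : ContinuousOn (fun x : ℝ => ∫ t in (0 : ℝ)..x, f t) (Set.Ioo (0 : ℝ) 1) := by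
    have h := intervalIntegral.continuousOn_primitive_interval' (μ := volume) (a := (0 : ℝ))
      (f.intervalIntegrable zero_le_one le_rfl) Set.left_mem_uIcc
    rw [Set.uIcc_of_le zero_le_one] at h
    exact h.mono Set.Ioo_subset_Icc_self
  refine MemLp.of_bound (hc.aestronglyMeasurable measurableSet_Ioo) ‖f‖ ?_
  filter_upwards [ae_restrict_mem measurableSet_Ioo] with x hx
  exact f.norm_primitive_le hx

/-- The simple integration operator `J : L²(0,1) → L²(0,1)`, `(J f)(x) = ∫₀ˣ f(t) dt`. -/
def integrationOp (𝕜 : Type*) [RCLike 𝕜] : L2Unit 𝕜 →L[𝕜] L2Unit 𝕜 :=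
  LinearMap.mkContinuous
    { toFun := fun f => (f.memLp_primitive).toLp (fun x : ℝ => ∫ t in (0 : ℝ)..x, f t)
      map_add' := by
        intro f g
        rw [← MemLp.toLp_add, MemLp.toLp_eq_toLp_iff]
        filter_upwards [ae_restrict_mem measurableSet_Ioo] with x hx
        rw [Pi.add_apply, ← intervalIntegral.integral_add
          (f.intervalIntegrable hx.1.le hx.2.le) (g.intervalIntegrable hx.1.le hx.2.le)]
        refine intervalIntegral.integral_congr_ae ?_
        have h := (ae_restrict_iff' measurableSet_Ioo).1 (Lp.coeFn_add f g)
        filter_upwards [h] with t ht hm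
        rw [Set.uIoc_of_le hx.1.le] at hm
        exact ht ⟨hm.1, hm.2.trans_lt hx.2⟩
      map_smul' := by
        intro c f
        rw [RingHom.id_apply, ← MemLp.toLp_const_smul, MemLp.toLp_eq_toLp_iff]
        filter_upwards [ae_restrict_mem measurableSet_Ioo] with x hx
        rw [Pi.smul_apply, ← intervalIntegral.integral_smul]
        refine intervalIntegral.integral_congr_ae ?_
        have h := (ae_restrict_iff' measurableSet_Ioo).1 (Lp.coeFn_smul c f)
        filter_upwards [h] with t ht hm
        rw [Set.uIoc_of_le hx.1.le] at hm
        exact ht ⟨hm.1, hm.2.trans_lt hx.2⟩ }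
    1
    (by
      intro f
      have : IsProbabilityMeasure (volume.restrict (Set.Ioo (0 : ℝ) 1)) := ⟨by simp⟩
      have h := Lp.norm_le_of_ae_bound (p := 2) (μ := volume.restrict (Set.Ioo (0 : ℝ) 1))
        (f := (f.memLp_primitive).toLp (fun x : ℝ => ∫ t in (0 : ℝ)..x, f t))
        (norm_nonneg f) (by
          filter_upwards [(f.memLp_primitive).coeFn_toLp,
            ae_restrict_mem measurableSet_Ioo] with x hx hm
          rw [hx]
          exact f.norm_primitive_le hm)
      simpa [measureUnivNNReal] using h)

theorem integrationOp_coeFn {𝕜 : Type*} [RCLike 𝕜] (f : L2Unit 𝕜) :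
    ∀ᵐ x ∂(volume.restrict (Set.Ioo (0 : ℝ) 1)),
      integrationOp 𝕜 f x = ∫ t in (0 : ℝ)..x, f t :=
  (f.memLp_primitive).coeFn_toLp

/-- The sum of the eigenspaces of `A* A` for the eigenvalues `t ^ 2` with `t ≥ s`; for compact `A`
and `s > 0` its dimension is the number of singular values `≥ s`, counted with multiplicity. -/
def singularSpace {𝕜 X Y : Type*} [RCLike 𝕜]
    [NormedAddCommGroup X] [InnerProductSpace 𝕜 X] [CompleteSpace X]
    [NormedAddCommGroup Y] [InnerProductSpace 𝕜 Y] [CompleteSpace Y]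
    (A : X →L[𝕜] Y) (s : ℝ) : Submodule 𝕜 X :=
  ⨆ t : ℝ, ⨆ _ : s ≤ t,
    Module.End.eigenspace ((ContinuousLinearMap.adjoint A ∘L A : X →L[𝕜] X) : X →ₗ[𝕜] X)
      ((t ^ 2 : ℝ) : 𝕜)

/-- The `n`-th singular value (`n = 1, 2, …`) of a compact operator `A`: the `n`-th term of the
nonincreasing list of the square roots of the eigenvalues of `A* A`, each repeated according to its
multiplicity; `0` if the list is shorter. It is the largest `s > 0` such that at least `n` terms
of the list are `≥ s`. -/
def singularValue {𝕜 X Y : Type*} [RCLike 𝕜]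
    [NormedAddCommGroup X] [InnerProductSpace 𝕜 X] [CompleteSpace X]
    [NormedAddCommGroup Y] [InnerProductSpace 𝕜 Y] [CompleteSpace Y]
    (A : X →L[𝕜] Y) (n : ℕ) : ℝ :=
  sSup {s : ℝ | 0 < s ∧ (n : Cardinal) ≤ Module.rank 𝕜 (singularSpace A s)}

end

/-! Both `A` and `B = J ^ k` have singular value decompositions `A b_n = σ_n u_n` and `B f_n = τ_n
g_n`. If the ratios `σ_n / τ_n` lie between two positive constants, the diagonal operator with these
entries is an isomorphism of `ℓ²`. The correspondences `b_n ↦ f_n` and `g_n ↦ u_n` are unitary, and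
the diagonal operator can be inserted into either of them; this is `exists_factorization`. The left
vectors `u_n` form a basis of the closure of the range of `A`, and the `g_n` one of all of
`L²(0,1)`, because `J ^ k` has dense range.

It remains to show that `τ_n` has order `n ^ (-k)`, by the two halves of the Courant–Fischer
principle. For the upper bound (`IsSingularBasis.norm_apply_le`), the Poincaré inequality
`norm_integrationOp_apply_le` is applied to each of the `k` integrations, at the cost of about `n /
k` linear conditions each. For the lower bound (`IsSingularBasis.le_norm_apply`),
`exists_submodule_le_norm_integrationOp_pow` uses the span of the `k`-th derivatives of disjoint
rescaled bumps. -/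

open Filter Topology in
/-- A compact operator maps only finitely many members of an orthonormal family to vectors of norm
at least `ε`, provided that the images are pairwise orthogonal. -/
theorem IsCompactOperator.finite_setOf_le_norm {𝕜 X Y ι : Type*} [RCLike 𝕜]
    [NormedAddCommGroup X] [InnerProductSpace 𝕜 X]
    [NormedAddCommGroup Y] [InnerProductSpace 𝕜 Y]
    {A : X →L[𝕜] Y} (hA : IsCompactOperator A) {w : ι → X} (hw : Orthonormal 𝕜 w)
    (ho : Pairwise fun i j => inner 𝕜 (A (w i)) (A (w j)) = 0) {ε : ℝ} (hε : 0 < ε) :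
    {i | ε ≤ ‖A (w i)‖}.Finite := by
  by_contra hinf
  let e := Set.Infinite.natEmbedding _ hinf
  obtain ⟨K, hK, hsub⟩ := IsCompactOperator.image_closedBall_subset_compact
    (f := (A : X →ₗ[𝕜] Y)) hA 1
  have hmem : ∀ n, A (w (e n)) ∈ K := fun n => hsub ⟨w (e n), by simp [hw.1], rfl⟩
  obtain ⟨y, -, φ, hφ, hlim⟩ := hK.tendsto_subseq hmem
  obtain ⟨N, hN⟩ := Metric.cauchySeq_iff.1 hlim.cauchySeq ε hε
  have h := hN N le_rfl (N + 1) (Nat.le_succ N)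
  have hne : ((e (φ N) : {i | ε ≤ ‖A (w i)‖}) : ι) ≠ e (φ (N + 1)) := fun hh =>
    absurd (hφ.injective (e.injective (Subtype.ext hh))) (by omega)
  -- By Pythagoras distinct images are at distance at least `ε`, so no subsequence is Cauchy.
  have h1 : ‖A (w (e (φ N)))‖ * ‖A (w (e (φ N)))‖ ≤
      dist (A (w (e (φ N)))) (A (w (e (φ (N + 1))))) *
        dist (A (w (e (φ N)))) (A (w (e (φ (N + 1))))) := by
    rw [dist_eq_norm, sub_eq_add_neg, norm_add_sq_eq_norm_sq_add_norm_sq_of_inner_eq_zero (𝕜 := 𝕜)]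
    · nlinarith [norm_nonneg (-A (w (e (φ (N + 1)))))]
    · rw [inner_neg_right, ho hne, neg_zero]
  have h2 : ε ≤ ‖A (w (e (φ N)))‖ := (e (φ N)).2
  simp only [Function.comp] at h
  nlinarith [dist_nonneg (x := A (w (e (φ N)))) (y := A (w (e (φ (N + 1)))))]

/-- A positive function with finite superlevel sets on an infinite type can be listed in
nonincreasing order. -/
theorem exists_equiv_nat_antitone {ι : Type*} [Infinite ι] (s : ι → ℝ) (hs : ∀ i, 0 < s i)
    (hfin : ∀ ε, 0 < ε → {i | ε ≤ s i}.Finite) : ∃ e : ℕ ≃ ι, Antitone fun n => s (e n) := by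
  have hc : Countable ι := by
    have hU : (Set.univ : Set ι) = ⋃ n : ℕ, {i | 1 / ((n : ℝ) + 1) ≤ s i} := by
      ext i
      obtain ⟨n, hn⟩ := exists_nat_one_div_lt (hs i)
      simpa using ⟨n, by simpa using hn.le⟩
    rw [← Set.countable_univ_iff, hU]
    exact Set.countable_iUnion fun n => (hfin _ (by positivity)).countable
  obtain ⟨c, hcinj⟩ := exists_injective_nat ι
  -- Order by decreasing `s`; ties are broken by an arbitrary injection into `ℕ`.
  let g : ι → ℝ ×ₗ ℕ := fun i => toLex (-s i, c i)
  have hg : Function.Injective g := fun i j h => by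
    have := congrArg (fun z => (ofLex z).2) h
    exact hcinj this
  let _ : LinearOrder ι := LinearOrder.lift' g hg
  have hle : ∀ {i j : ι}, i ≤ j → s j ≤ s i := by
    intro i j h
    have h' : g i ≤ g j := h
    rcases (Prod.Lex.le_iff).1 h' with h1 | h1
    · have : -s i < -s j := h1
      linarith
    · have : -s i = -s j := h1.1
      linarith
  -- Finite initial segments, a least element and no greatest one characterise the order type of
  -- `ℕ`.
  have hIic : ∀ j : ι, (Set.Iic j).Finite := fun j =>
    (hfin _ (hs j)).subset fun i hi => hle hi
  let _ : LocallyFiniteOrder ι := LocallyFiniteOrder.ofFiniteIcc fun a b =>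
    (hIic b).subset Set.Icc_subset_Iic_self
  obtain ⟨i0⟩ : Nonempty ι := inferInstance
  obtain ⟨m, -, hm⟩ := Set.exists_min_image (Set.Iic i0) id (hIic i0) ⟨i0, le_refl i0⟩
  let _ : OrderBot ι :=
    { bot := m
      bot_le := fun a => by
        rcases le_total a i0 with h | h
        · exact hm a h
        · exact (hm i0 (le_refl i0)).trans h }
  have : NoMaxOrder ι := ⟨fun a => by
    by_contra! h
    exact Set.infinite_univ ((hIic a).subset fun b _ => h b)⟩
  let _ : SuccOrder ι := LinearLocallyFiniteOrder.succOrder ι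
  let _ : PredOrder ι := LinearLocallyFiniteOrder.predOrder ι
  let e : ι ≃o ℕ := orderIsoNatOfLinearSuccPredArch
  exact ⟨e.symm.toEquiv, fun a b hab => hle (e.symm.monotone hab)⟩

/-! ### Existence of right singular vectors -/

section SVD

open ContinuousLinearMap

universe u v

variable {𝕜 : Type u} {X : Type v} {Y : Type*} [RCLike 𝕜]
  [NormedAddCommGroup X] [InnerProductSpace 𝕜 X] [CompleteSpace X]
  [NormedAddCommGroup Y] [InnerProductSpace 𝕜 Y] [CompleteSpace Y]

/-- The right singular vectors of an operator: an orthonormal basis `b` of eigenvectors of `A* A`,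
arranged so that `‖A (b n)‖` is nonincreasing. -/
structure IsSingularBasis (A : X →L[𝕜] Y) (b : HilbertBasis ℕ 𝕜 X) : Prop where
  apply_adjoint : ∀ n, (adjoint A) (A (b n)) = ((‖A (b n)‖ ^ 2 : ℝ) : 𝕜) • b n
  antitone : Antitone fun n => ‖A (b n)‖
  finite : ∀ ε, 0 < ε → {n | ε ≤ ‖A (b n)‖}.Finite

theorem inner_map_map_of_adjoint_apply_eq {A : X →L[𝕜] Y} {x y : X} {t : 𝕜}
    (h : (adjoint A) (A x) = t • x) : inner 𝕜 (A y) (A x) = t * inner 𝕜 y x := by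
  rw [← adjoint_inner_right, h, inner_smul_right]

/-- The eigenspaces of the compact self-adjoint operator `A* A` are mutually orthogonal with dense
sum, so their orthonormal bases combine into one of `X`. Pairing `A* A x = μ x` with a unit vector
`x` gives `μ = ‖A x‖²`. -/
theorem exists_hilbertBasis_of_isCompactOperator {A : X →L[𝕜] Y} (hA : IsCompactOperator A) :
    ∃ (ι : Type (max u v)) (b : HilbertBasis ι 𝕜 X),
      ∀ i, (adjoint A) (A (b i)) = ((‖A (b i)‖ ^ 2 : ℝ) : 𝕜) • b i := by
  let B : X →L[𝕜] X := adjoint A ∘L A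
  have hB : IsCompactOperator B := hA.clm_comp (adjoint A)
  have hBs : (B : X →ₗ[𝕜] X).IsSymmetric := fun x y => by
    simp [B, adjoint_inner_left, adjoint_inner_right]
  have hcl : ∀ μ, IsClosed (Module.End.eigenspace (B : X →ₗ[𝕜] X) μ : Set X) := fun μ => by
    have : (Module.End.eigenspace (B : X →ₗ[𝕜] X) μ : Set X) = {x | B x = μ • x} := by
      ext x
      simp
    rw [this]
    exact isClosed_eq B.continuous (continuous_const_smul μ)
  have : ∀ μ, CompleteSpace (Module.End.eigenspace (B : X →ₗ[𝕜] X) μ) :=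
    fun μ => (hcl μ).completeSpace_coe
  choose w₀ b₀ hb₀ using fun μ => exists_hilbertBasis 𝕜 (Module.End.eigenspace (B : X →ₗ[𝕜] X) μ)
  have hon := hBs.orthogonalFamily_eigenspaces.orthonormal_sigma_orthonormal
    fun μ => (b₀ μ).orthonormal
  have hperp : (Submodule.span 𝕜 (Set.range fun a : Σ μ, w₀ μ =>
      (Module.End.eigenspace (B : X →ₗ[𝕜] X) a.1).subtypeₗᵢ (b₀ a.1 a.2)))ᗮ = ⊥ := by
    rw [eq_bot_iff, ← orthogonalComplement_iSup_eigenspaces_eq_bot hB hBs]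
    intro x hx
    rw [Submodule.mem_orthogonal] at hx ⊢
    intro u hu
    induction hu using Submodule.iSup_induction' with
    | zero => simp
    | add y z _ _ hy hz => rw [inner_add_left, hy, hz, add_zero]
    | mem μ y hy =>
      have hK : Dense ((Submodule.span 𝕜 (Set.range (b₀ μ)) : Submodule 𝕜 _) : Set
          (Module.End.eigenspace (B : X →ₗ[𝕜] X) μ)) := by
        rw [Submodule.dense_iff_topologicalClosure_eq_top]
        exact (b₀ μ).dense_span
      -- Orthogonality to a basis of each eigenspace passes to the whole eigenspace by density and
      -- continuity.
      have hcont : Continuous fun z : Module.End.eigenspace (B : X →ₗ[𝕜] X) μ =>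
          inner 𝕜 (z : X) x := by fun_prop
      have := hcont.ext_on hK (continuous_const (y := (0 : 𝕜))) (fun z hz => by
        induction hz using Submodule.span_induction with
        | zero => simp
        | add p q _ _ hp hq => simp only [Submodule.coe_add, inner_add_left, hp, hq, add_zero]
        | smul c p _ hp => simp only [Submodule.coe_smul, inner_smul_left, hp, mul_zero]
        | mem p hp =>
          obtain ⟨i, rfl⟩ := hp
          exact hx _ (Submodule.subset_span ⟨⟨μ, i⟩, rfl⟩))
      exact congrFun this ⟨y, hy⟩
  refine ⟨Σ μ, w₀ μ, HilbertBasis.mkOfOrthogonalEqBot hon hperp, fun j => ?_⟩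
  rw [HilbertBasis.coe_mkOfOrthogonalEqBot]
  set x : X := (Module.End.eigenspace (B : X →ₗ[𝕜] X) j.1).subtypeₗᵢ (b₀ j.1 j.2) with hx
  have h1 : adjoint A (A x) = j.1 • x :=
    Module.End.mem_eigenspace_iff.1 (b₀ j.1 j.2).2
  have h2 : ‖x‖ = 1 := hon.1 j
  have h3 := inner_map_map_of_adjoint_apply_eq (y := x) h1
  rw [inner_self_eq_norm_sq_to_K, inner_self_eq_norm_sq_to_K, h2] at h3
  rw [h1]
  congr 1
  simpa using h3.symm

theorem exists_isSingularBasis (hX : ¬ FiniteDimensional 𝕜 X) {A : X →L[𝕜] Y}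
    (hA : IsCompactOperator A) (hinj : Function.Injective A) :
    ∃ b : HilbertBasis ℕ 𝕜 X, IsSingularBasis A b := by
  obtain ⟨ι, b, hb⟩ := exists_hilbertBasis_of_isCompactOperator hA
  have hinf : Infinite ι := by
    by_contra h
    rw [not_infinite_iff_finite] at h
    have := Fintype.ofFinite ι
    exact hX b.toOrthonormalBasis.toBasis.finiteDimensional_of_finite
  have ho : Pairwise fun i j => inner 𝕜 (A (b i)) (A (b j)) = 0 := fun i j hij => by
    simp only [inner_map_map_of_adjoint_apply_eq (hb j), b.orthonormal.2 hij, mul_zero]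
  have hpos : ∀ i, 0 < ‖A (b i)‖ := fun i => by
    rw [norm_pos_iff, Ne, map_eq_zero_iff A hinj]
    exact b.orthonormal.ne_zero i
  have hfin := fun ε (hε : 0 < ε) => hA.finite_setOf_le_norm b.orthonormal ho hε
  obtain ⟨e, he⟩ := exists_equiv_nat_antitone _ hpos hfin
  have hspan : (Submodule.span 𝕜 (Set.range (b ∘ e)))ᗮ = ⊥ := by
    rw [e.surjective.range_comp, ← Submodule.topologicalClosure_eq_top_iff]
    exact b.dense_span
  refine ⟨HilbertBasis.mkOfOrthogonalEqBot (b.orthonormal.comp e e.injective) hspan, ?_⟩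
  constructor
  · intro n
    simpa only [HilbertBasis.coe_mkOfOrthogonalEqBot, Function.comp_apply] using hb (e n)
  · simpa only [HilbertBasis.coe_mkOfOrthogonalEqBot, Function.comp_apply] using he
  · intro ε hε
    simpa only [HilbertBasis.coe_mkOfOrthogonalEqBot, Function.comp_apply] using!
      (hfin ε hε).preimage e.injective.injOn

end SVD

/-! ### Parseval's identity and operators determined on a basis -/

section HilbertBasis

variable {𝕜 : Type*} {X : Type*} {Y : Type*} [RCLike 𝕜]
  [NormedAddCommGroup X] [InnerProductSpace 𝕜 X]
  [NormedAddCommGroup Y] [InnerProductSpace 𝕜 Y]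

theorem HilbertBasis.hasSum_norm_inner_sq {ι : Type*} (b : HilbertBasis ι 𝕜 X) (x : X) :
    HasSum (fun n => ‖inner 𝕜 (b n) x‖ ^ 2) (‖x‖ ^ 2) := by
  have h1 := b.hasSum_inner_mul_inner x x
  rw [inner_self_eq_norm_sq_to_K] at h1
  rw [← RCLike.hasSum_ofReal (𝕜 := 𝕜)]
  push_cast
  convert h1 using 2 with n
  rw [← inner_conj_symm x (b n), RCLike.conj_mul]

theorem HilbertBasis.clm_ext {ι : Type*} (b : HilbertBasis ι 𝕜 X) {f g : X →L[𝕜] Y}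
    (h : ∀ i, f (b i) = g (b i)) : f = g := by
  refine ContinuousLinearMap.ext_on (s := Set.range b) ?_ ?_
  · rw [Submodule.dense_iff_topologicalClosure_eq_top]
    exact b.dense_span
  · rintro _ ⟨i, rfl⟩
    exact h i

end HilbertBasis

/-! ### Courant–Fischer bounds, singular values and factorization -/

section SVD

open ContinuousLinearMap

variable {𝕜 : Type*} {X : Type*} {Y : Type*} [RCLike 𝕜]
  [NormedAddCommGroup X] [InnerProductSpace 𝕜 X] [CompleteSpace X]
  [NormedAddCommGroup Y] [InnerProductSpace 𝕜 Y] [CompleteSpace Y]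

namespace IsSingularBasis

variable {A : X →L[𝕜] Y} {b : HilbertBasis ℕ 𝕜 X}

theorem inner_apply_apply (h : IsSingularBasis A b) {i j : ℕ} (hij : i ≠ j) :
    inner 𝕜 (A (b i)) (A (b j)) = 0 := by
  rw [inner_map_map_of_adjoint_apply_eq (h.apply_adjoint j), b.orthonormal.2 hij, mul_zero]

theorem inner_adjoint_apply (h : IsSingularBasis A b) (n : ℕ) (x : X) :
    inner 𝕜 (b n) (adjoint A (A x)) = ((‖A (b n)‖ ^ 2 : ℝ) : 𝕜) * inner 𝕜 (b n) x := by
  rw [adjoint_inner_right, ← adjoint_inner_left, h.apply_adjoint, inner_smul_left,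
    RCLike.conj_ofReal]

/-- Parseval applied to `⟨x, A* A x⟩`, with `A* A` diagonal in the basis `b`. Both Courant–Fischer
bounds compare this series with that of `‖x‖²` term by term. -/
theorem hasSum_norm_apply_sq (h : IsSingularBasis A b) (x : X) :
    HasSum (fun n => ‖A (b n)‖ ^ 2 * ‖inner 𝕜 (b n) x‖ ^ 2) (‖A x‖ ^ 2) := by
  have h1 := b.hasSum_inner_mul_inner x (adjoint A (A x))
  rw [adjoint_inner_right, inner_self_eq_norm_sq_to_K] at h1
  rw [← RCLike.hasSum_ofReal (𝕜 := 𝕜)]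
  push_cast
  convert h1 using 2 with n
  rw [h.inner_adjoint_apply, ← inner_conj_symm x (b n), mul_left_comm, RCLike.conj_mul]
  push_cast
  rfl

/-- If `‖A x‖ ≥ d ‖x‖` on a subspace of dimension greater than `n`, then `‖A (b n)‖ ≥ d`. -/
theorem le_norm_apply (h : IsSingularBasis A b) {n : ℕ} {d : ℝ}
    (V : Submodule 𝕜 X) [FiniteDimensional 𝕜 V] (hV : n < Module.finrank 𝕜 V)
    (hVA : ∀ x ∈ V, d * ‖x‖ ≤ ‖A x‖) : d ≤ ‖A (b n)‖ := by
  -- Some nonzero `x ∈ V` is orthogonal to `b 0, …, b (n - 1)`; only weights at most `‖A (b n)‖²`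
  -- remain in its series.
  let l : V →ₗ[𝕜] (Fin n → 𝕜) := LinearMap.pi fun i =>
    ((innerSL 𝕜 (b i) : X →L[𝕜] 𝕜) : X →ₗ[𝕜] 𝕜) ∘ₗ V.subtype
  have hk : LinearMap.ker l ≠ ⊥ := LinearMap.ker_ne_bot_of_finrank_lt (by simpa using hV)
  obtain ⟨⟨x, hxV⟩, hxl, hx0⟩ := Submodule.exists_mem_ne_zero_of_ne_bot hk
  have hx0 : x ≠ 0 := fun hh => hx0 (Subtype.ext hh)
  have hz : ∀ i < n, inner 𝕜 (b i) x = 0 := fun i hi => congrFun hxl ⟨i, hi⟩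
  have hle : ‖A x‖ ^ 2 ≤ ‖A (b n)‖ ^ 2 * ‖x‖ ^ 2 := by
    refine hasSum_le (fun i => ?_) (h.hasSum_norm_apply_sq x)
      ((b.hasSum_norm_inner_sq x).mul_left (‖A (b n)‖ ^ 2))
    rcases lt_or_ge i n with hi | hi
    · simp [hz i hi]
    · gcongr
      exact h.antitone hi
  have hle' : ‖A x‖ ≤ ‖A (b n)‖ * ‖x‖ :=
    (sq_le_sq₀ (by positivity) (by positivity)).1 (by rwa [mul_pow])
  exact le_of_mul_le_mul_right ((hVA x hxV).trans hle') (norm_pos_iff.2 hx0)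

/-- If `‖A x‖ ≤ d ‖x‖` on the common kernel of at most `n` functionals, then `‖A (b n)‖ ≤ d`. -/
theorem norm_apply_le (h : IsSingularBasis A b) {n : ℕ} {d : ℝ} {W : Type*} [AddCommGroup W]
    [Module 𝕜 W] [FiniteDimensional 𝕜 W] (hW : Module.finrank 𝕜 W ≤ n) (l : X →ₗ[𝕜] W)
    (hl : ∀ x, l x = 0 → ‖A x‖ ≤ d * ‖x‖) : ‖A (b n)‖ ≤ d := by
  -- The `n + 1` vectors `b 0, …, b n` span a space too large for `l` to be injective on it, and
  -- there every weight is at least `‖A (b n)‖²`.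
  let v : Fin (n + 1) → X := fun i => b i
  have hv : LinearIndependent 𝕜 v :=
    b.orthonormal.linearIndependent.comp _ Fin.val_injective
  let V := Submodule.span 𝕜 (Set.range v)
  have hVf : Module.finrank 𝕜 V = n + 1 := by simpa using finrank_span_eq_card hv
  have hfin : FiniteDimensional 𝕜 V := FiniteDimensional.span_of_finite 𝕜 (Set.finite_range v)
  have hk : LinearMap.ker (l ∘ₗ V.subtype) ≠ ⊥ :=
    LinearMap.ker_ne_bot_of_finrank_lt (by omega)
  obtain ⟨⟨x, hxV⟩, hxl, hx0⟩ := Submodule.exists_mem_ne_zero_of_ne_bot hk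
  have hx0 : x ≠ 0 := fun hh => hx0 (Subtype.ext hh)
  have hz : ∀ i, n < i → inner 𝕜 (b i) x = 0 := by
    intro i hi
    have hle : V ≤ ((innerSL 𝕜 (b i) : X →L[𝕜] 𝕜)).ker := by
      rw [Submodule.span_le]
      rintro _ ⟨j, rfl⟩
      exact b.orthonormal.2 (by omega)
    exact hle hxV
  have hle : ‖A (b n)‖ ^ 2 * ‖x‖ ^ 2 ≤ ‖A x‖ ^ 2 := by
    refine hasSum_le (fun i => ?_) ((b.hasSum_norm_inner_sq x).mul_left (‖A (b n)‖ ^ 2))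
      (h.hasSum_norm_apply_sq x)
    rcases lt_or_ge n i with hi | hi
    · simp [hz i hi]
    · gcongr
      exact h.antitone hi
  have hle' : ‖A (b n)‖ * ‖x‖ ≤ ‖A x‖ :=
    (sq_le_sq₀ (by positivity) (by positivity)).1 (by rwa [mul_pow])
  exact le_of_mul_le_mul_right (hle'.trans (hl x hxl)) (norm_pos_iff.2 hx0)

theorem singularSpace_eq_span (h : IsSingularBasis A b) {s : ℝ} (hs : 0 < s) :
    singularSpace A s = Submodule.span 𝕜 (Set.range fun n : {n | s ≤ ‖A (b n)‖} => b n) := by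
  apply le_antisymm
  · refine iSup₂_le fun t ht x hx => ?_
    have hx' : adjoint A (A x) = ((t ^ 2 : ℝ) : 𝕜) • x := Module.End.mem_eigenspace_iff.1 hx
    -- Comparing coefficients gives `(t² - ‖A (b n)‖²) ⟨b n, x⟩ = 0`, and the first factor is
    -- nonzero when `‖A (b n)‖ < s ≤ t`.
    have hz : ∀ n ∉ (h.finite s hs).toFinset, b.repr x n • b n = 0 := by
      intro n hn
      simp only [Set.Finite.mem_toFinset, Set.mem_ofPred_eq, not_le] at hn
      have h1 := h.inner_adjoint_apply n x
      rw [hx', inner_smul_right, ← sub_eq_zero, ← sub_mul, mul_eq_zero, ← RCLike.ofReal_sub,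
        RCLike.ofReal_eq_zero] at h1
      rw [b.repr_apply_apply]
      rcases h1 with h1 | h1
      · nlinarith [norm_nonneg (A (b n))]
      · simp [h1]
    rw [(b.hasSum_repr x).unique (hasSum_sum_of_ne_finset_zero hz)]
    refine Submodule.sum_mem _ fun n hn => Submodule.smul_mem _ _ (Submodule.subset_span ?_)
    exact ⟨⟨n, by simpa using hn⟩, rfl⟩
  · rw [Submodule.span_le]
    rintro _ ⟨⟨n, hn⟩, rfl⟩
    refine Submodule.mem_iSup_of_mem ‖A (b n)‖ (Submodule.mem_iSup_of_mem hn ?_)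
    exact Module.End.mem_eigenspace_iff.2 (h.apply_adjoint n)

theorem natCast_le_rank_singularSpace_iff (h : IsSingularBasis A b) {s : ℝ} (hs : 0 < s)
    (n : ℕ) : ((n + 1 : ℕ) : Cardinal) ≤ Module.rank 𝕜 (singularSpace A s) ↔ s ≤ ‖A (b n)‖ := by
  have hv : LinearIndependent 𝕜 (fun m : {m | s ≤ ‖A (b m)‖} => b m) :=
    b.orthonormal.linearIndependent.comp _ Subtype.val_injective
  have hF := h.finite s hs
  have hrank : Module.rank 𝕜 (singularSpace A s) = ({m | s ≤ ‖A (b m)‖}.ncard : Cardinal) := by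
    have := hF.fintype
    have := FiniteDimensional.span_of_finite 𝕜
      (Set.finite_range fun m : {m | s ≤ ‖A (b m)‖} => b m)
    rw [h.singularSpace_eq_span hs, ← Module.finrank_eq_rank, finrank_span_eq_card hv,
      ← Nat.card_eq_fintype_card, Nat.card_coe_set_eq]
  rw [hrank, Nat.cast_le]
  constructor
  · intro hle
    by_contra! hlt
    have hsub : {m | s ≤ ‖A (b m)‖} ⊆ Set.Iio n := fun m hm => by
      by_contra hmn
      exact absurd (hm.trans (h.antitone (not_lt.1 hmn))) (not_le.2 hlt)
    have := Set.ncard_le_ncard hsub (Set.finite_Iio n)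
    simp at this
    omega
  · intro hle
    have hsub : Set.Iio (n + 1) ⊆ {m | s ≤ ‖A (b m)‖} := fun m hm =>
      hle.trans (h.antitone (Nat.lt_succ_iff.1 hm))
    have := Set.ncard_le_ncard hsub hF
    simpa using this

/-- Counting from `0` in the basis and from `1` in `singularValue` accounts for the shift. -/
theorem singularValue_eq (h : IsSingularBasis A b) (n : ℕ) (hn : 0 < ‖A (b n)‖) :
    singularValue A (n + 1) = ‖A (b n)‖ := by
  have : {s : ℝ | 0 < s ∧ ((n + 1 : ℕ) : Cardinal) ≤ Module.rank 𝕜 (singularSpace A s)} =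
      Set.Ioc 0 ‖A (b n)‖ := by
    ext s
    exact and_congr_right fun hs => h.natCast_le_rank_singularSpace_iff hs n
  rw [singularValue, this, csSup_Ioc hn]

end IsSingularBasis

/-- Diagonal operators with entries bounded above and below are isomorphisms of `ℓ²`. -/
theorem exists_diagonal_equiv (a : ℕ → ℝ) {m M : ℝ} (hm : 0 < m) (ha : ∀ n, m ≤ a n)
    (hM : ∀ n, a n ≤ M) :
    ∃ D : lp (fun _ : ℕ => 𝕜) 2 ≃L[𝕜] lp (fun _ : ℕ => 𝕜) 2, ∀ f n, D f n = (a n : 𝕜) * f n := by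
  have key : ∀ (a : ℕ → ℝ) (M : ℝ), (∀ n, |a n| ≤ M) →
      ∃ D : lp (fun _ : ℕ => 𝕜) 2 →L[𝕜] lp (fun _ : ℕ => 𝕜) 2,
        ∀ f n, D f n = (a n : 𝕜) * f n := by
    intro a M hM
    have hb : ∀ (f : lp (fun _ : ℕ => 𝕜) 2) n, ‖(a n : 𝕜) * f n‖ ≤ ‖((M : 𝕜) • f) n‖ := by
      intro f n
      rw [lp.coeFn_smul, Pi.smul_apply, norm_smul, norm_mul, RCLike.norm_ofReal,
        RCLike.norm_ofReal]
      exact mul_le_mul_of_nonneg_right ((hM n).trans (le_abs_self M)) (norm_nonneg _)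
    let D₀ : lp (fun _ : ℕ => 𝕜) 2 →ₗ[𝕜] lp (fun _ : ℕ => 𝕜) 2 :=
      { toFun := fun f => ⟨fun n => (a n : 𝕜) * f n, (lp.memℓp ((M : 𝕜) • f)).mono' (hb f)⟩
        map_add' := fun f g => by
          ext n
          exact mul_add _ _ _
        map_smul' := fun c f => by
          ext n
          exact mul_left_comm _ _ _ }
    exact ⟨D₀.mkContinuous ‖(M : 𝕜)‖ fun f =>
      (lp.norm_mono (by norm_num) (hb f)).trans (norm_smul_le _ _), fun f n => rfl⟩
  have hpos : ∀ n, 0 < a n := fun n => hm.trans_le (ha n)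
  obtain ⟨D, hD⟩ := key a M fun n => by rw [abs_of_pos (hpos n)]; exact hM n
  obtain ⟨D', hD'⟩ := key (fun n => (a n)⁻¹) m⁻¹ fun n => by
    rw [abs_of_pos (inv_pos.2 (hpos n))]
    exact inv_anti₀ hm (ha n)
  have hne : ∀ n, (a n : 𝕜) ≠ 0 := fun n => RCLike.ofReal_ne_zero.2 (hpos n).ne'
  refine ⟨ContinuousLinearEquiv.equivOfInverse D D' (fun f => ?_) (fun f => ?_), hD⟩
  · ext n
    rw [hD', hD, RCLike.ofReal_inv, inv_mul_cancel_left₀ (hne n)]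
  · ext n
    rw [hD, hD', RCLike.ofReal_inv, mul_inv_cancel_left₀ (hne n)]

/-- The normalised images `A (b n)` are orthonormal because the `b n` are eigenvectors of `A* A`. A
vector of the closed range orthogonal to all of them is orthogonal to the range, hence to itself. -/
theorem IsSingularBasis.exists_leftBasis {A : X →L[𝕜] Y} {b : HilbertBasis ℕ 𝕜 X}
    (h : IsSingularBasis A b) (hinj : Function.Injective A) :
    ∃ u : HilbertBasis ℕ 𝕜 A.range.topologicalClosure,
      ∀ n, A (b n) = ((‖A (b n)‖ : ℝ) : 𝕜) • (u n : Y) := by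
  have hpos : ∀ i, 0 < ‖A (b i)‖ := fun i => by
    rw [norm_pos_iff, Ne, map_eq_zero_iff A hinj]
    exact b.orthonormal.ne_zero i
  let K := A.range.topologicalClosure
  have hmem : ∀ x, A x ∈ K := fun x => A.range.le_topologicalClosure ⟨x, rfl⟩
  let u : ℕ → K := fun n => ((‖A (b n)‖⁻¹ : ℝ) : 𝕜) • ⟨A (b n), hmem _⟩
  have hu : Orthonormal 𝕜 u := by
    constructor
    · intro n
      simp only [u, norm_smul, RCLike.norm_ofReal, abs_inv, abs_norm, Submodule.coe_norm]
      exact inv_mul_cancel₀ (hpos n).ne'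
    · intro i j hij
      simp only [u, inner_smul_left, inner_smul_right, Submodule.coe_inner,
        h.inner_apply_apply hij, mul_zero]
  have hAu : ∀ n, A (b n) = ((‖A (b n)‖ : ℝ) : 𝕜) • (u n : Y) := fun n => by
    simp only [u, Submodule.coe_smul, smul_smul, ← RCLike.ofReal_mul,
      mul_inv_cancel₀ (hpos n).ne', RCLike.ofReal_one, one_smul]
  have hperp : (Submodule.span 𝕜 (Set.range u))ᗮ = ⊥ := by
    rw [eq_bot_iff]
    intro y hy
    rw [Submodule.mem_orthogonal] at hy
    have h1 : innerSL 𝕜 (y : Y) ∘L A = 0 := b.clm_ext fun n => by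
      have := hy (u n) (Submodule.subset_span ⟨n, rfl⟩)
      rw [Submodule.coe_inner, inner_eq_zero_symm] at this
      simp only [coe_comp, Function.comp_apply, innerSL_apply_apply, zero_apply]
      rw [hAu, inner_smul_right, this, mul_zero]
    have h2 : K ≤ (innerSL 𝕜 (y : Y)).ker := by
      refine Submodule.topologicalClosure_minimal _ ?_ (innerSL 𝕜 (y : Y)).isClosed_ker
      rintro _ ⟨x, rfl⟩
      exact congrFun (congrArg DFunLike.coe h1) x
    have h3 : inner 𝕜 (y : Y) (y : Y) = 0 := h2 y.2
    exact Subtype.ext (inner_self_eq_zero.1 h3)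
  refine ⟨HilbertBasis.mkOfOrthogonalEqBot hu hperp, ?_⟩
  rwa [HilbertBasis.coe_mkOfOrthogonalEqBot]

/-- Two injective operators with comparable singular values, the second with dense range, differ by
an isomorphism on one side and a unitary operator on the other. -/
theorem exists_factorization {Z : Type*} [NormedAddCommGroup Z] [InnerProductSpace 𝕜 Z]
    [CompleteSpace Z] {A : X →L[𝕜] Y} {B : Z →L[𝕜] Z} (hA : Function.Injective A)
    (hB : Function.Injective B) (hBd : DenseRange B) {b : HilbertBasis ℕ 𝕜 X}
    {f : HilbertBasis ℕ 𝕜 Z} (hb : IsSingularBasis A b) (hf : IsSingularBasis B f) {m M : ℝ}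
    (hm : 0 < m) (hmA : ∀ n, m * ‖B (f n)‖ ≤ ‖A (b n)‖) (hMA : ∀ n, ‖A (b n)‖ ≤ M * ‖B (f n)‖) :
    (∃ (S : Z ≃ₗᵢ[𝕜] A.range.topologicalClosure) (T : X ≃L[𝕜] Z),
        ∀ x : X, A x = (S (B (T x)) : Y)) ∧
      (∃ (S : Z ≃L[𝕜] A.range.topologicalClosure) (T : X ≃ₗᵢ[𝕜] Z),
        ∀ x : X, A x = (S (B (T x)) : Y)) := by
  have hpos : ∀ i, 0 < ‖B (f i)‖ := fun i => by
    rw [norm_pos_iff, Ne, map_eq_zero_iff B hB]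
    exact f.orthonormal.ne_zero i
  obtain ⟨u, hu⟩ := hb.exists_leftBasis hA
  obtain ⟨g₀, hg₀⟩ := hf.exists_leftBasis hB
  have htop : B.range.topologicalClosure = ⊤ := by
    rw [← Submodule.dense_iff_topologicalClosure_eq_top]
    exact hBd
  obtain ⟨g, hg⟩ : ∃ g : HilbertBasis ℕ 𝕜 Z, ∀ n, B (f n) = ((‖B (f n)‖ : ℝ) : 𝕜) • g n := by
    let e : B.range.topologicalClosure ≃ₗᵢ[𝕜] Z :=
      (LinearIsometryEquiv.ofEq _ _ htop).trans (LinearIsometryEquiv.ofTop _ _ rfl)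
    refine ⟨HilbertBasis.ofRepr (e.symm.trans g₀.repr), fun n => ?_⟩
    refine (hg₀ n).trans (congrArg _ ?_)
    rw [← HilbertBasis.repr_symm_single, ← HilbertBasis.repr_symm_single]
    rfl
  -- The ratios of singular values, bounded below by `m` and above by `M`.
  let a : ℕ → ℝ := fun n => ‖A (b n)‖ / ‖B (f n)‖
  obtain ⟨D, hD⟩ := exists_diagonal_equiv (𝕜 := 𝕜) a hm (M := M)
    (fun n => (le_div_iff₀ (hpos n)).2 (hmA n)) (fun n => (div_le_iff₀ (hpos n)).2 (hMA n))
  have hDs : ∀ n, D (lp.single 2 n (1 : 𝕜)) = (a n : 𝕜) • lp.single 2 n (1 : 𝕜) := fun n => by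
    ext j
    rw [hD, lp.coeFn_smul, Pi.smul_apply, smul_eq_mul]
    rcases eq_or_ne j n with rfl | hj
    · rfl
    · simp [hj]
  have hab : ∀ n, (a n : 𝕜) * ((‖B (f n)‖ : ℝ) : 𝕜) = ((‖A (b n)‖ : ℝ) : 𝕜) := fun n => by
    rw [← RCLike.ofReal_mul, div_mul_cancel₀ _ (hpos n).ne']
  let S : Z ≃ₗᵢ[𝕜] A.range.topologicalClosure := g.repr.trans u.repr.symm
  let T : X ≃ₗᵢ[𝕜] Z := b.repr.trans f.repr.symm
  constructor
  · let T' : X ≃L[𝕜] Z := (b.repr.toContinuousLinearEquiv.trans D).trans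
      f.repr.symm.toContinuousLinearEquiv
    refine ⟨S, T', fun x => ?_⟩
    have : A = A.range.topologicalClosure.subtypeL ∘L (S : Z →L[𝕜] A.range.topologicalClosure) ∘L
        B ∘L (T' : X →L[𝕜] Z) := b.clm_ext fun n => by
      have h1 : T' (b n) = (a n : 𝕜) • f n := by
        change f.repr.symm (D (b.repr (b n))) = _
        rw [b.repr_self, hDs, map_smul, f.repr_symm_single]
      have h2 : S (g n) = u n := by
        change u.repr.symm (g.repr (g n)) = _
        rw [g.repr_self, u.repr_symm_single]
      change A (b n) = (S (B (T' (b n))) : Y)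
      rw [h1, map_smul, hg, map_smul, map_smul, h2, hu, Submodule.coe_smul, Submodule.coe_smul,
        smul_smul, hab]
    exact congrFun (congrArg DFunLike.coe this) x
  · let S' : Z ≃L[𝕜] A.range.topologicalClosure := (g.repr.toContinuousLinearEquiv.trans D).trans
      u.repr.symm.toContinuousLinearEquiv
    refine ⟨S', T, fun x => ?_⟩
    have : A = A.range.topologicalClosure.subtypeL ∘L (S' : Z →L[𝕜] A.range.topologicalClosure) ∘L
        B ∘L (T : X →L[𝕜] Z) := b.clm_ext fun n => by
      have h1 : T (b n) = f n := by
        change f.repr.symm (b.repr (b n)) = _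
        rw [b.repr_self, f.repr_symm_single]
      have h2 : S' (g n) = (a n : 𝕜) • u n := by
        change u.repr.symm (D (g.repr (g n))) = _
        rw [g.repr_self, hDs, map_smul, u.repr_symm_single]
      change A (b n) = (S' (B (T (b n))) : Y)
      rw [h1, hg, map_smul, h2, hu, Submodule.coe_smul, Submodule.coe_smul, smul_smul,
        mul_comm, hab]
    exact congrFun (congrArg DFunLike.coe this) x

end SVD

/-! ### Compactness by finite-rank approximation -/

section CompactnessCriterion

variable {𝕜 X Y W : Type*} [RCLike 𝕜]
  [NormedAddCommGroup X] [InnerProductSpace 𝕜 X] [CompleteSpace X]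
  [NormedAddCommGroup Y] [NormedSpace 𝕜 Y] [CompleteSpace Y]

/-- An operator is compact if it is small on closed subspaces of finite codimension. -/
theorem isCompactOperator_of_forall_exists_ker {A : X →L[𝕜] Y}
    (h : ∀ ε : ℝ, 0 < ε → ∃ (n : ℕ) (l : X →L[𝕜] (Fin n → 𝕜)),
      ∀ x, l x = 0 → ‖A x‖ ≤ ε * ‖x‖) : IsCompactOperator A := by
  have hcl : IsClosed {B : X →L[𝕜] Y | IsCompactOperator B} :=
    isClosed_setOfPred_isCompactOperator
  refine hcl.closure_subset (Metric.mem_closure_iff.2 fun ε hε => ?_)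
  obtain ⟨n, l, hl⟩ := h (ε / 2) (by positivity)
  let K := l.ker
  have hK : CompleteSpace K := l.isClosed_ker.completeSpace_coe
  have hfin : FiniteDimensional 𝕜 Kᗮ := by
    refine FiniteDimensional.of_injective ((l : X →ₗ[𝕜] (Fin n → 𝕜)) ∘ₗ Kᗮ.subtype) ?_
    rw [← LinearMap.ker_eq_bot, LinearMap.ker_eq_bot']
    intro x hx
    have hxK : (x : X) ∈ K := hx
    exact Subtype.ext (inner_self_eq_zero.1 (x.2 _ hxK))
  have : ProperSpace Kᗮ := FiniteDimensional.proper_rclike 𝕜 Kᗮ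
  -- With `K = ker l`, the space `Kᗮ` is finite-dimensional since `l` is injective on it. The error
  -- of this finite-rank approximation is `A` composed with the projection onto `K`, of norm at most
  -- `ε / 2`.
  refine ⟨(A ∘L Kᗮ.subtypeL) ∘L Kᗮ.orthogonalProjectionOnto, ?_, ?_⟩
  · exact (isCompactOperator_of_locallyCompactSpace_rng
      (A ∘L Kᗮ.subtypeL)).comp_clm _
  · rw [dist_eq_norm]
    refine (ContinuousLinearMap.opNorm_le_bound _ (by positivity) fun x => ?_).trans_lt
      (half_lt_self hε)
    have hx : (A - (A ∘L Kᗮ.subtypeL) ∘L Kᗮ.orthogonalProjectionOnto) x =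
        A (K.orthogonalProjectionOnto x : X) := by
      have := K.starProjection_add_starProjection_orthogonal x
      simp only [sub_apply, ContinuousLinearMap.comp_apply,
        Submodule.subtypeL_apply]
      rw [← map_sub]
      congr 1
      rw [sub_eq_iff_eq_add]
      exact this.symm
    rw [hx]
    have h1 := hl _ (K.orthogonalProjectionOnto x).2
    have h2 := K.norm_orthogonalProjectionOnto_apply_le x
    exact h1.trans (by gcongr; exact h2)

end CompactnessCriterion

/-! ### Poincaré inequality and upper bound for the singular values of `J ^ k` -/

section Interval

open intervalIntegral Set

variable {𝕜 : Type*} [RCLike 𝕜]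

theorem norm_integral_sq_le {f : ℝ → 𝕜} {a x b : ℝ} (hax : a ≤ x) (hxb : x ≤ b)
    (hf : IntervalIntegrable f volume a b)
    (hf2 : IntervalIntegrable (fun t => ‖f t‖ ^ 2) volume a b) :
    ‖∫ t in a..x, f t‖ ^ 2 ≤ (b - a) * ∫ t in a..b, ‖f t‖ ^ 2 := by
  have hab := hax.trans hxb
  set m := ∫ t in a..b, ‖f t‖ with hm
  have h1 : ‖∫ t in a..x, f t‖ ≤ m :=
    (intervalIntegral.norm_integral_le_integral_norm hax).trans
      (integral_mono_interval le_rfl hax hxb (Filter.Eventually.of_forall fun _ => norm_nonneg _)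
        hf.norm)
  have h2 : m ^ 2 ≤ (b - a) * ∫ t in a..b, ‖f t‖ ^ 2 := by
    -- Cauchy–Schwarz from the integral of the square `((b - a) ‖f‖ - m)²`.
    have h3 : 0 ≤ ∫ t in a..b, ((b - a) ^ 2 * ‖f t‖ ^ 2 - (2 * (b - a) * m * ‖f t‖ - m ^ 2)) :=
      integral_nonneg hab fun t _ => by nlinarith [sq_nonneg ((b - a) * ‖f t‖ - m)]
    rw [integral_sub (hf2.const_mul _) ((hf.norm.const_mul _).sub intervalIntegrable_const),
      integral_sub (hf.norm.const_mul _) intervalIntegrable_const,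
      intervalIntegral.integral_const_mul, intervalIntegral.integral_const_mul,
      intervalIntegral.integral_const, ← hm, smul_eq_mul] at h3
    rcases hab.eq_or_lt with rfl | hlt
    · simp [hm]
    · have h4 : 0 < b - a := sub_pos.2 hlt
      have h5 : (b - a) * m ^ 2 ≤ (b - a) * ((b - a) * ∫ t in a..b, ‖f t‖ ^ 2) := by nlinarith
      exact le_of_mul_le_mul_left h5 h4
  exact (pow_le_pow_left₀ (norm_nonneg _) h1 2).trans h2

theorem setIntegral_Ioo_eq_intervalIntegral {E : Type*} [NormedAddCommGroup E] [NormedSpace ℝ E]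
    (f : ℝ → E) : ∫ t, f t ∂(volume.restrict (Ioo (0 : ℝ) 1)) = ∫ t in (0 : ℝ)..1, f t := by
  rw [integral_of_le zero_le_one, integral_Ioc_eq_integral_Ioo]

theorem L2Unit.inner_eq (f g : L2Unit 𝕜) :
    inner 𝕜 f g = ∫ t in (0 : ℝ)..1, inner 𝕜 (f t) (g t) := by
  rw [L2.inner_def, setIntegral_Ioo_eq_intervalIntegral]

theorem L2Unit.norm_sq_eq (f : L2Unit 𝕜) : ‖f‖ ^ 2 = ∫ t in (0 : ℝ)..1, ‖f t‖ ^ 2 := by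
  have h := L2Unit.inner_eq f f
  simp only [inner_self_eq_norm_sq_to_K] at h
  rw [← RCLike.ofReal_inj (K := 𝕜), RCLike.ofReal_pow, h, integral_of_le zero_le_one,
    integral_of_le zero_le_one, ← _root_.integral_ofReal]
  simp

theorem L2Unit.intervalIntegrable_of_mem (f : L2Unit 𝕜) {a b : ℝ} (ha : a ∈ Icc (0 : ℝ) 1)
    (hb : b ∈ Icc (0 : ℝ) 1) : IntervalIntegrable (f : ℝ → 𝕜) volume a b :=
  (f.intervalIntegrable ha.1 ha.2).symm.trans (f.intervalIntegrable hb.1 hb.2)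

theorem L2Unit.intervalIntegrable_norm_sq (f : L2Unit 𝕜) {a b : ℝ} (ha : a ∈ Icc (0 : ℝ) 1)
    (hb : b ∈ Icc (0 : ℝ) 1) : IntervalIntegrable (fun t => ‖f t‖ ^ 2) volume a b := by
  have h : IntervalIntegrable (fun t => ‖f t‖ ^ 2) volume 0 1 := by
    rw [intervalIntegrable_iff_integrableOn_Ioo_of_le zero_le_one]
    exact (Lp.memLp f).integrable_norm_pow (by norm_num)
  refine h.mono_set ?_
  rw [uIcc_of_le zero_le_one]
  exact uIcc_subset_Icc ha hb

theorem L2Unit.continuousOn_primitive (f : L2Unit 𝕜) :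
    ContinuousOn (fun x : ℝ => ∫ t in (0 : ℝ)..x, f t) (Icc 0 1) := by
  have h := intervalIntegral.continuousOn_primitive_interval' (μ := volume) (a := (0 : ℝ))
    (f.intervalIntegrable zero_le_one le_rfl) Set.left_mem_uIcc
  rwa [Set.uIcc_of_le zero_le_one] at h

theorem norm_integrationOp_apply_sq (f : L2Unit 𝕜) :
    ‖integrationOp 𝕜 f‖ ^ 2 = ∫ x in (0 : ℝ)..1, ‖∫ t in (0 : ℝ)..x, f t‖ ^ 2 := by
  rw [L2Unit.norm_sq_eq, ← setIntegral_Ioo_eq_intervalIntegral,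
    ← setIntegral_Ioo_eq_intervalIntegral]
  refine integral_congr_ae ?_
  filter_upwards [integrationOp_coeFn f] with x hx
  rw [hx]

theorem natCast_div_mem_Icc {n i : ℕ} (hi : i ≤ n) : (i : ℝ) / n ∈ Icc (0 : ℝ) 1 :=
  ⟨by positivity, div_le_one_of_le₀ (by exact_mod_cast hi) (by positivity)⟩

/-- A Poincaré inequality: if the primitive of `f` vanishes at the points `i / n`, then its norm
is at most `‖f‖ / n`. -/
theorem norm_integrationOp_apply_le {n : ℕ} (hn : 0 < n) (f : L2Unit 𝕜)
    (hf : ∀ i ≤ n, ∫ t in (0 : ℝ)..(i / n : ℝ), f t = 0) :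
    ‖integrationOp 𝕜 f‖ ≤ 1 / n * ‖f‖ := by
  have hn' : (0 : ℝ) < n := by exact_mod_cast hn
  let a : ℕ → ℝ := fun i => (i : ℝ) / n
  have ha : ∀ i ≤ n, a i ∈ Icc (0 : ℝ) 1 := fun i hi => natCast_div_mem_Icc hi
  have ha0 : a 0 = 0 := by simp [a]
  have han : a n = 1 := div_self hn'.ne'
  have hstep : ∀ i, a (i + 1) - a i = 1 / n := fun i => by
    simp only [a]
    push_cast
    ring
  have hmono : ∀ i, a i ≤ a (i + 1) := fun i => by
    have : (0 : ℝ) ≤ 1 / n := by positivity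
    linarith [hstep i]
  have hI : ∀ i < n, IntervalIntegrable (fun x => ‖∫ t in (0 : ℝ)..x, f t‖ ^ 2) volume
      (a i) (a (i + 1)) := fun i hi => by
    refine ContinuousOn.intervalIntegrable ((f.continuousOn_primitive.norm.pow 2).mono ?_)
    exact uIcc_subset_Icc (ha i hi.le) (ha (i + 1) hi)
  have key : ‖integrationOp 𝕜 f‖ ^ 2 ≤ (1 / n * ‖f‖) ^ 2 := by
    have hs1 := sum_integral_adjacent_intervals hI
    have hs2 := sum_integral_adjacent_intervals (f := fun t => ‖f t‖ ^ 2) fun i (hi : i < n) =>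
      f.intervalIntegrable_norm_sq (ha i hi.le) (ha (i + 1) hi)
    rw [ha0, han] at hs1 hs2
    rw [norm_integrationOp_apply_sq, mul_pow, L2Unit.norm_sq_eq, ← hs1, ← hs2, Finset.mul_sum]
    refine Finset.sum_le_sum fun i hi => ?_
    have hi := Finset.mem_range.1 hi
    -- The primitive restarts from `0` in each cell. Cauchy–Schwarz yields one factor `1 / n`, and
    -- integrating over the cell yields the other.
    have h1 : ∀ x ∈ Icc (a i) (a (i + 1)), ‖∫ t in (0 : ℝ)..x, f t‖ ^ 2 ≤
        1 / n * ∫ t in (a i)..(a (i + 1)), ‖f t‖ ^ 2 := by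
      intro x hx
      have hx1 : x ∈ Icc (0 : ℝ) 1 := ⟨(ha i hi.le).1.trans hx.1, hx.2.trans (ha _ hi).2⟩
      have h0 : (0 : ℝ) ∈ Icc (0 : ℝ) 1 := ⟨le_rfl, zero_le_one⟩
      rw [← integral_add_adjacent_intervals (f.intervalIntegrable_of_mem h0 (ha i hi.le))
        (f.intervalIntegrable_of_mem (ha i hi.le) hx1), hf i hi.le, zero_add, ← hstep i]
      exact norm_integral_sq_le hx.1 hx.2 (f.intervalIntegrable_of_mem (ha i hi.le) (ha _ hi))
        (f.intervalIntegrable_norm_sq (ha i hi.le) (ha _ hi))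
    refine (integral_mono_on (hmono i) (hI i hi) intervalIntegrable_const h1).trans_eq ?_
    rw [intervalIntegral.integral_const, hstep, smul_eq_mul]
    ring
  exact (sq_le_sq₀ (norm_nonneg _) (by positivity)).1 key

theorem exists_clm_eq_primitive (𝕜 : Type*) [RCLike 𝕜] {x : ℝ} (hx : x ∈ Icc (0 : ℝ) 1) :
    ∃ l : L2Unit 𝕜 →L[𝕜] 𝕜, ∀ f : L2Unit 𝕜, l f = ∫ t in (0 : ℝ)..x, f t := by
  refine ⟨innerSL 𝕜 (indicatorConstLp 2 (measurableSet_Ioo (a := (0 : ℝ)) (b := x))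
    (measure_ne_top _ _) (1 : 𝕜)), fun f => ?_⟩
  rw [innerSL_apply_apply, L2.inner_indicatorConstLp_one, Measure.restrict_restrict
    measurableSet_Ioo, inter_eq_left.2 (Ioo_subset_Ioo_right hx.2), integral_of_le hx.1,
    integral_Ioc_eq_integral_Ioo]

/-- The values of a primitive at the points `(i + 1) / n`. -/
theorem exists_clm_norm_integrationOp_le (𝕜 : Type*) [RCLike 𝕜] {n : ℕ} (hn : 0 < n) :
    ∃ l : L2Unit 𝕜 →L[𝕜] (Fin n → 𝕜),
      ∀ f, l f = 0 → ‖integrationOp 𝕜 f‖ ≤ 1 / n * ‖f‖ := by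
  choose l hl using fun i : Fin n =>
    exists_clm_eq_primitive 𝕜 (natCast_div_mem_Icc (Nat.succ_le_of_lt i.2))
  -- The primitive vanishes at `0` automatically, so `n` functionals suffice for `n + 1` points.
  refine ⟨ContinuousLinearMap.pi l, fun f hf => norm_integrationOp_apply_le hn f fun i hi => ?_⟩
  rcases i with _ | i
  · simp
  · rw [← hl ⟨i, hi⟩ f]
    exact congrFun hf ⟨i, hi⟩

theorem isCompactOperator_integrationOp : IsCompactOperator (integrationOp 𝕜) := by
  refine isCompactOperator_of_forall_exists_ker fun ε hε => ?_
  obtain ⟨n, hn⟩ := exists_nat_one_div_lt hε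
  obtain ⟨l, hl⟩ := exists_clm_norm_integrationOp_le 𝕜 n.succ_pos
  refine ⟨n + 1, l, fun f hf => (hl f hf).trans ?_⟩
  gcongr
  exact_mod_cast hn.le

theorem isCompactOperator_integrationOp_pow {k : ℕ} (hk : k ≠ 0) :
    IsCompactOperator (integrationOp 𝕜 ^ k) := by
  obtain ⟨j, rfl⟩ := Nat.exists_eq_succ_of_ne_zero hk
  rw [pow_succ]
  exact isCompactOperator_integrationOp.clm_comp (integrationOp 𝕜 ^ j)

theorem norm_integrationOp_le_one : ‖integrationOp 𝕜‖ ≤ 1 :=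
  LinearMap.mkContinuous_norm_le _ zero_le_one _

theorem norm_singular_integrationOp_pow_le {k : ℕ} (hk : k ≠ 0)
    {f : HilbertBasis ℕ 𝕜 (L2Unit 𝕜)} (hf : IsSingularBasis (integrationOp 𝕜 ^ k) f) (N : ℕ) :
    ‖(integrationOp 𝕜 ^ k) (f N)‖ ≤ (2 * k / (N + 1) : ℝ) ^ k := by
  have hN : (0 : ℝ) < N + 1 := by positivity
  -- For `N < k` there are too few conditions, but `‖J‖ ≤ 1` suffices, as the claimed bound is then
  -- at least `1`.
  rcases Nat.eq_zero_or_pos (N / k) with h0 | hpos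
  · have hlt : N < k := (Nat.div_eq_zero_iff_lt (Nat.pos_of_ne_zero hk)).1 h0
    have h1 : ‖(integrationOp 𝕜 ^ k) (f N)‖ ≤ 1 := by
      refine (ContinuousLinearMap.le_opNorm _ _).trans ?_
      rw [f.orthonormal.1, mul_one]
      exact (norm_pow_le' _ (Nat.pos_of_ne_zero hk)).trans
        (pow_le_one₀ (norm_nonneg _) norm_integrationOp_le_one)
    refine h1.trans (one_le_pow₀ ((one_le_div hN).2 ?_))
    have : (N : ℝ) + 1 ≤ k := by exact_mod_cast hlt
    linarith
  · set n := N / k with hn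
    obtain ⟨l, hl⟩ := exists_clm_norm_integrationOp_le 𝕜 hpos
    -- The Poincaré conditions are imposed on `x, J x, …, J ^ (k - 1) x`; these are `k * ⌊N / k⌋ ≤
    -- N` functionals.
    let L : L2Unit 𝕜 →ₗ[𝕜] (Fin k → Fin n → 𝕜) := LinearMap.pi fun j =>
      (l ∘L (integrationOp 𝕜 ^ (j : ℕ)) : L2Unit 𝕜 →L[𝕜] (Fin n → 𝕜))
    have hle : ‖(integrationOp 𝕜 ^ k) (f N)‖ ≤ (1 / n : ℝ) ^ k := by
      refine hf.norm_apply_le (W := Fin k → Fin n → 𝕜) ?_ L fun x hx => ?_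
      · rw [Module.finrank_pi_fintype]
        simp only [Module.finrank_fintype_fun_eq_card, Fintype.card_fin, Finset.sum_const,
          Finset.card_univ, smul_eq_mul]
        exact Nat.mul_div_le N k
      · have hj : ∀ j ≤ k, ‖(integrationOp 𝕜 ^ j) x‖ ≤ (1 / n : ℝ) ^ j * ‖x‖ := by
          intro j
          induction j with
          | zero => simp
          | succ j ih =>
            intro hj
            rw [pow_succ', pow_succ', mul_assoc]
            have hx' : l ((integrationOp 𝕜 ^ j) x) = 0 := congrFun hx ⟨j, hj⟩
            refine (hl _ hx').trans ?_
            gcongr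
            exact ih (by omega)
        exact hj k le_rfl
    refine hle.trans (pow_le_pow_left₀ (by positivity) ?_ k)
    have hn' : (0 : ℝ) < n := by exact_mod_cast hpos
    rw [div_le_div_iff₀ hn' hN]
    have h1 : N + 1 ≤ 2 * k * n := by
      have := Nat.lt_div_mul_add (a := N) (Nat.pos_of_ne_zero hk)
      have : k * 1 ≤ k * n := Nat.mul_le_mul_left k hpos
      nlinarith
    have : (N : ℝ) + 1 ≤ 2 * k * n := by exact_mod_cast h1
    linarith

end Interval

/-! ### Injectivity and dense range of `J ^ k` -/

section Density

open intervalIntegral Set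

variable {𝕜 : Type*} [RCLike 𝕜]

theorem memLp_two_of_continuous {g : ℝ → 𝕜} (hg : Continuous g) :
    MemLp g 2 (volume.restrict (Ioo (0 : ℝ) 1)) := by
  obtain ⟨C, hC⟩ := isCompact_Icc.exists_bound_of_continuousOn (s := Icc (0 : ℝ) 1) hg.continuousOn
  refine MemLp.of_bound hg.aestronglyMeasurable C ?_
  filter_upwards [ae_restrict_mem measurableSet_Ioo] with x hx
  exact hC x (Ioo_subset_Icc_self hx)

theorem inner_toLp_two {g h : ℝ → 𝕜} (hg : MemLp g 2 (volume.restrict (Ioo (0 : ℝ) 1)))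
    (f : L2Unit 𝕜) (hfh : f =ᵐ[volume.restrict (Ioo (0 : ℝ) 1)] h) :
    inner 𝕜 (hg.toLp g) f = ∫ t in (0 : ℝ)..1, inner 𝕜 (g t) (h t) := by
  rw [L2.inner_def, ← setIntegral_Ioo_eq_intervalIntegral]
  refine integral_congr_ae ?_
  filter_upwards [hg.coeFn_toLp, hfh] with t h1 h2
  rw [h1, h2]

theorem norm_toLp_two_sq {g : ℝ → 𝕜} (hg : MemLp g 2 (volume.restrict (Ioo (0 : ℝ) 1))) :
    ‖hg.toLp g‖ ^ 2 = ∫ t in (0 : ℝ)..1, ‖g t‖ ^ 2 := by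
  rw [L2Unit.norm_sq_eq, ← setIntegral_Ioo_eq_intervalIntegral,
    ← setIntegral_Ioo_eq_intervalIntegral]
  refine integral_congr_ae ?_
  filter_upwards [hg.coeFn_toLp] with t h1
  rw [h1]

/-- The fundamental theorem of calculus for the integration operator. -/
theorem integrationOp_toLp {g g' : ℝ → 𝕜} (hg : ∀ x, HasDerivAt g (g' x) x) (hg' : Continuous g')
    (h0 : g 0 = 0) (hm : MemLp g 2 (volume.restrict (Ioo (0 : ℝ) 1)))
    (hm' : MemLp g' 2 (volume.restrict (Ioo (0 : ℝ) 1))) :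
    integrationOp 𝕜 (hm'.toLp g') = hm.toLp g := by
  refine Lp.ext ?_
  filter_upwards [integrationOp_coeFn (hm'.toLp g'), hm.coeFn_toLp,
    ae_restrict_mem measurableSet_Ioo] with x hx h1 hx01
  rw [hx, h1]
  have h2 : ∫ t in (0 : ℝ)..x, hm'.toLp g' t = ∫ t in (0 : ℝ)..x, g' t := by
    refine intervalIntegral.integral_congr_ae ?_
    filter_upwards [(ae_restrict_iff' measurableSet_Ioo).1 hm'.coeFn_toLp] with t ht hmem
    rw [uIoc_of_le hx01.1.le] at hmem
    exact ht ⟨hmem.1, hmem.2.trans_lt hx01.2⟩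
  rw [h2, integral_eq_sub_of_hasDerivAt (fun t _ => hg t) (hg'.intervalIntegrable _ _), h0,
    sub_zero]

theorem hasDerivAt_ofReal_comp {g : ℝ → ℝ} {g' x : ℝ} (h : HasDerivAt g g' x) :
    HasDerivAt (fun t => (g t : 𝕜)) (g' : 𝕜) x :=
  (RCLike.ofRealCLM (K := 𝕜)).hasFDerivAt.comp_hasDerivAt x h

/-- If `J f = 0`, the continuous primitive of `f` vanishes on all of `(0, 1)`, and by Lebesgue
differentiation its derivative is `f` almost everywhere. -/
theorem integrationOp_injective : Function.Injective (integrationOp 𝕜) := by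
  rw [injective_iff_map_eq_zero]
  intro f hf
  have hae : (fun x : ℝ => ∫ t in (0 : ℝ)..x, f t) =ᵐ[volume.restrict (Ioo (0 : ℝ) 1)]
      fun _ => (0 : 𝕜) := by
    have h0 := Lp.coeFn_zero 𝕜 2 (volume.restrict (Ioo (0 : ℝ) 1))
    filter_upwards [integrationOp_coeFn f, h0] with x hx h0
    rw [← hx, hf, h0]
    rfl
  have heq : EqOn (fun x : ℝ => ∫ t in (0 : ℝ)..x, f t) (fun _ => (0 : 𝕜)) (Ioo 0 1) :=
    Measure.eqOn_open_of_ae_eq hae isOpen_Ioo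
      (f.continuousOn_primitive.mono Ioo_subset_Icc_self) continuousOn_const
  rw [Lp.eq_zero_iff_ae_eq_zero]
  have hd := (f.intervalIntegrable zero_le_one le_rfl).ae_hasDerivAt_integral
  rw [uIcc_of_le zero_le_one] at hd
  filter_upwards [ae_restrict_of_ae hd, ae_restrict_mem measurableSet_Ioo] with x hx hx01
  have h1 := hx (Ioo_subset_Icc_self hx01) 0 ⟨le_rfl, zero_le_one⟩
  have h2 : HasDerivAt (fun x : ℝ => ∫ t in (0 : ℝ)..x, f t) 0 x :=
    (hasDerivAt_const x (0 : 𝕜)).congr_of_eventuallyEq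
      (Filter.eventuallyEq_of_mem (isOpen_Ioo.mem_nhds hx01) heq)
  exact h1.unique h2

/-- Every test function `g` on `(0, 1)` equals `J g'`, so a function orthogonal to the range
integrates to `0` against all test functions. -/
theorem denseRange_integrationOp : DenseRange (integrationOp 𝕜) := by
  have : (integrationOp 𝕜).range.topologicalClosure = ⊤ := by
    rw [Submodule.topologicalClosure_eq_top_iff, eq_bot_iff]
    intro f hf
    rw [Submodule.mem_orthogonal] at hf
    have hloc : LocallyIntegrableOn (f : ℝ → 𝕜) (Ioo 0 1) volume :=
      f.integrableOn.locallyIntegrableOn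
    have hz := isOpen_Ioo.ae_eq_zero_of_integral_contDiff_smul_eq_zero hloc
      fun g hg hgc hgs => by
        have hzero : ∀ x, x ∉ Ioo (0 : ℝ) 1 → g x = 0 := fun x hx =>
          image_eq_zero_of_notMem_tsupport fun h => hx (hgs h)
        have hd : ∀ x, HasDerivAt (fun t => (g t : 𝕜)) ((deriv g x : ℝ) : 𝕜) x := fun x =>
          hasDerivAt_ofReal_comp (hg.differentiable (by simp) x).hasDerivAt
        have hcd : Continuous fun x => ((deriv g x : ℝ) : 𝕜) :=
          RCLike.continuous_ofReal.comp (hg.continuous_deriv (by simp))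
        have hc : Continuous fun x => (g x : 𝕜) := RCLike.continuous_ofReal.comp hg.continuous
        have h1 := integrationOp_toLp hd hcd (by simp [hzero]) (memLp_two_of_continuous hc)
          (memLp_two_of_continuous hcd)
        have h2 := hf _ ⟨_, h1⟩
        rw [inner_toLp_two _ f (Filter.EventuallyEq.refl _ _),
          ← setIntegral_Ioo_eq_intervalIntegral] at h2
        rw [← setIntegral_eq_integral_of_forall_compl_eq_zero (s := Ioo (0 : ℝ) 1)
          fun x hx => by rw [hzero x hx, zero_smul], ← h2]
        congr 1
        ext x
        rw [RCLike.inner_apply, RCLike.conj_ofReal, mul_comm, RCLike.real_smul_eq_coe_mul]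
    refine (Lp.eq_zero_iff_ae_eq_zero).2 ?_
    exact (ae_restrict_iff' measurableSet_Ioo).2 hz
  exact Submodule.dense_iff_topologicalClosure_eq_top.2 this

theorem integrationOp_pow_injective (k : ℕ) : Function.Injective (integrationOp 𝕜 ^ k) := by
  induction k with
  | zero => exact Function.injective_id
  | succ k ih =>
    rw [pow_succ]
    exact ih.comp integrationOp_injective

theorem denseRange_integrationOp_pow (k : ℕ) :
    DenseRange (integrationOp 𝕜 ^ k : L2Unit 𝕜 →L[𝕜] L2Unit 𝕜) := by
  induction k with
  | zero => exact Function.surjective_id.denseRange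
  | succ k ih =>
    rw [pow_succ]
    exact ih.comp denseRange_integrationOp (integrationOp 𝕜 ^ k).continuous

end Density

/-! ### Lower bound for the singular values of `J ^ k` -/

section Bumps

open intervalIntegral Set

/-- The successive derivatives of a smooth bump function supported in `(0, 1)`. -/
theorem exists_bump_derivatives : ∃ ψ : ℕ → ℝ → ℝ, (∀ j, Continuous (ψ j)) ∧
    (∀ j x, HasDerivAt (ψ j) (ψ (j + 1) x) x) ∧ (∀ j, ∀ x ∉ Ioo (0 : ℝ) 1, ψ j x = 0) ∧
    ∃ x, ψ 0 x ≠ 0 := by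
  -- The support is `[1/4, 3/4]`, inside `(0, 1)`.
  let φ : ContDiffBump (1 / 2 : ℝ) := ⟨1 / 8, 1 / 4, by norm_num, by norm_num⟩
  have hφ : ContDiff ℝ (⊤ : ℕ∞) φ := φ.contDiff
  have hdiff : ∀ j x, HasDerivAt (iteratedDeriv j φ) (iteratedDeriv (j + 1) φ x) x := fun j x => by
    rw [iteratedDeriv_succ]
    exact (hφ.differentiable_iteratedDeriv j (by exact_mod_cast WithTop.coe_lt_top _) x).hasDerivAt
  have hsupp : ∀ j, tsupport (iteratedDeriv j φ) ⊆ tsupport φ := by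
    intro j
    induction j with
    | zero => simp
    | succ j ih =>
      rw [iteratedDeriv_succ]
      exact tsupport_deriv_subset.trans ih
  refine ⟨fun j => iteratedDeriv j φ, fun j => ?_, hdiff, fun j x hx => ?_, 1 / 2, ?_⟩
  · exact continuous_iff_continuousAt.2 fun x => (hdiff j x).continuousAt
  · refine image_eq_zero_of_notMem_tsupport fun h => hx ?_
    have := hsupp j h
    rw [φ.tsupport_eq, Real.closedBall_eq_Icc] at this
    exact ⟨by have := this.1; norm_num at this ⊢; linarith,
      by have := this.2; norm_num at this ⊢; linarith⟩
  · simp only [iteratedDeriv_zero]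
    exact (φ.pos_of_mem_ball (Metric.mem_ball_self φ.rOut_pos)).ne'

variable {𝕜 : Type*} [RCLike 𝕜]

theorem norm_sum_smul_sq_of_pairwise {E ι : Type*} [NormedAddCommGroup E] [InnerProductSpace 𝕜 E]
    [Fintype ι] {e : ι → E} {r : ℝ} (he : ∀ i, ‖e i‖ ^ 2 = r)
    (ho : Pairwise fun i j => inner 𝕜 (e i) (e j) = 0) (c : ι → 𝕜) :
    ‖∑ i, c i • e i‖ ^ 2 = r * ∑ i, ‖c i‖ ^ 2 := by
  classical
  have h : inner 𝕜 (∑ i, c i • e i) (∑ i, c i • e i) = ((r * ∑ i, ‖c i‖ ^ 2 : ℝ) : 𝕜) := by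
    rw [sum_inner]
    push_cast
    rw [Finset.mul_sum]
    refine Finset.sum_congr rfl fun i _ => ?_
    rw [inner_sum, Finset.sum_eq_single i]
    · rw [inner_smul_left, inner_smul_right, inner_self_eq_norm_sq_to_K, ← mul_assoc,
        RCLike.conj_mul, ← he i, mul_comm]
      push_cast
      rfl
    · intro j _ hj
      rw [inner_smul_left, inner_smul_right, ho hj.symm, mul_zero, mul_zero]
    · simp
  rw [inner_self_eq_norm_sq_to_K] at h
  exact_mod_cast h

/-- There are subspaces of dimension `N + 1`, spanned by disjoint bumps, on which `J ^ k` is bounded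
below by a multiple of `(N + 1) ^ (-k)`. -/
theorem exists_submodule_le_norm_integrationOp_pow (𝕜 : Type*) [RCLike 𝕜] (k : ℕ) :
    ∃ δ : ℝ, 0 < δ ∧ ∀ N : ℕ, ∃ V : Submodule 𝕜 (L2Unit 𝕜), Module.finrank 𝕜 V = N + 1 ∧
      ∀ x ∈ V, δ * (1 / (N + 1) : ℝ) ^ k * ‖x‖ ≤ ‖(integrationOp 𝕜 ^ k) x‖ := by
  obtain ⟨ψ, hcont, hder, hzero, x₀, hx₀⟩ := exists_bump_derivatives
  let r : ℕ → ℝ := fun j => ∫ x, ψ j x ^ 2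
  have hr0 : 0 < r 0 := by
    have hc : HasCompactSupport (fun x => ψ 0 x ^ 2) :=
      HasCompactSupport.intro (isCompact_Icc (a := (0 : ℝ)) (b := 1)) fun x hx => by
        simp [hzero 0 x fun h => hx (Ioo_subset_Icc_self h)]
    exact ((hcont 0).pow 2).integral_pos_of_hasCompactSupport_nonneg_nonzero hc
      (fun x => sq_nonneg _) (x := x₀) (pow_ne_zero 2 hx₀)
  have hrk : 0 ≤ r k := integral_nonneg fun x => sq_nonneg _
  -- Up to scaling, `r 0 / r k` is the squared ratio of the norms of a bump and its `k`-th
  -- derivative; the `+ 1` avoids proving `r k ≠ 0`.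
  refine ⟨Real.sqrt (r 0 / (r k + 1)), Real.sqrt_pos.2 (by positivity), fun N => ?_⟩
  let n : ℝ := N + 1
  have hn : 0 < n := by positivity
  -- Copies of `ψ j` squeezed into the disjoint cells `(i / n, (i + 1) / n)`; integrating lowers `j`
  -- by one and costs a factor `n⁻¹`.
  let g : ℕ → Fin (N + 1) → ℝ → 𝕜 := fun j i x => (ψ j (n * x - (i : ℕ)) : 𝕜)
  have hg : ∀ j i, Continuous (g j i) := fun j i =>
    RCLike.continuous_ofReal.comp ((hcont j).comp (by fun_prop))
  let e : ℕ → Fin (N + 1) → L2Unit 𝕜 := fun j i => (memLp_two_of_continuous (hg j i)).toLp (g j i)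
  have hJ : ∀ j i, integrationOp 𝕜 (e (j + 1) i) = ((n⁻¹ : ℝ) : 𝕜) • e j i := by
    intro j i
    have hd : ∀ x, HasDerivAt (((n⁻¹ : ℝ) : 𝕜) • g j i) (g (j + 1) i x) x := fun x => by
      have h1 : HasDerivAt (fun x => ψ j (n * x - (i : ℕ))) (ψ (j + 1) (n * x - (i : ℕ)) * n) x :=
        (hder j _).comp x (((hasDerivAt_id x).const_mul n |>.sub_const _).congr_deriv (by simp))
      refine ((hasDerivAt_ofReal_comp (𝕜 := 𝕜) h1).const_smul ((n⁻¹ : ℝ) : 𝕜)).congr_deriv ?_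
      rw [smul_eq_mul, ← RCLike.ofReal_mul, mul_comm, mul_inv_cancel_right₀ hn.ne']
    have h0 : (((n⁻¹ : ℝ) : 𝕜) • g j i) 0 = 0 := by
      have : ψ j (n * 0 - (i : ℕ)) = 0 := hzero j _ fun h => by
        have h1 := h.1
        have : (0 : ℝ) ≤ (i : ℕ) := Nat.cast_nonneg _
        linarith
      simp only [Pi.smul_apply, g, this, RCLike.ofReal_zero, smul_zero]
    rw [← MemLp.toLp_const_smul]
    exact integrationOp_toLp hd (hg (j + 1) i) h0 _ _
  have hJk : ∀ j i, (integrationOp 𝕜 ^ j) (e j i) = ((n⁻¹ ^ j : ℝ) : 𝕜) • e 0 i := by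
    intro j
    induction j with
    | zero => intro i; simp
    | succ j ih =>
      intro i
      have : (integrationOp 𝕜 ^ (j + 1)) (e (j + 1) i) =
          (integrationOp 𝕜 ^ j) (integrationOp 𝕜 (e (j + 1) i)) := by
        rw [pow_succ]
        rfl
      rw [this, hJ, map_smul, ih, smul_smul, ← RCLike.ofReal_mul, pow_succ']
  have hnorm : ∀ j i, ‖e j i‖ ^ 2 = n⁻¹ * r j := by
    intro j i
    have h1 : ∀ x, ‖g j i x‖ ^ 2 = (fun y => ψ j y ^ 2) (n * x - (i : ℕ)) := fun x => by
      simp [g]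
    rw [norm_toLp_two_sq]
    rw [intervalIntegral.integral_congr fun x _ => h1 x, integral_comp_mul_sub (fun y => ψ j y ^ 2) hn.ne' ((i : ℕ) : ℝ), smul_eq_mul, integral_eq_integral_of_support_subset]
    intro x hx
    have hx' : x ∈ Ioo (0 : ℝ) 1 := by
      by_contra h
      exact hx (by simp [hzero j x h])
    have hi : ((i : ℕ) : ℝ) + 1 ≤ n := by
      have : (((i : ℕ) + 1 : ℕ) : ℝ) ≤ ((N + 1 : ℕ) : ℝ) := Nat.cast_le.2 i.2
      simpa only [n, Nat.cast_add, Nat.cast_one] using this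
    have hi0 : (0 : ℝ) ≤ (i : ℕ) := Nat.cast_nonneg _
    exact ⟨by linarith [hx'.1], by linarith [hx'.2]⟩
  have horth : ∀ j, Pairwise fun i i' => inner 𝕜 (e j i) (e j i') = 0 := by
    intro j i i' hii'
    have h1 : ∀ x, inner 𝕜 (g j i x) (g j i' x) = 0 := fun x => by
      by_cases h : n * x - (i : ℕ) ∈ Ioo (0 : ℝ) 1
      · have h' : n * x - (i' : ℕ) ∉ Ioo (0 : ℝ) 1 := fun h' => by
          apply hii'
          have h3 : ((i : ℕ) : ℝ) < (i' : ℕ) + 1 := by linarith [h.1, h'.2]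
          have h4 : ((i' : ℕ) : ℝ) < (i : ℕ) + 1 := by linarith [h.2, h'.1]
          have h3' : (i : ℕ) < i' + 1 := by exact_mod_cast h3
          have h4' : (i' : ℕ) < i + 1 := by exact_mod_cast h4
          exact Fin.ext (by omega)
        simp [g, hzero j _ h']
      · simp [g, hzero j _ h]
    change inner 𝕜 (e j i) (e j i') = 0
    rw [inner_toLp_two _ _ (memLp_two_of_continuous (hg j i')).coeFn_toLp,
      intervalIntegral.integral_congr fun x _ => h1 x, intervalIntegral.integral_zero]
  have he0 : ∀ i, e 0 i ≠ 0 := fun i h => by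
    have := hnorm 0 i
    rw [h, norm_zero] at this
    have : 0 < n⁻¹ * r 0 := by positivity
    linarith
  have hek : ∀ i, e k i ≠ 0 := fun i h => by
    have h1 := hJk k i
    rw [h, map_zero] at h1
    exact smul_ne_zero (RCLike.ofReal_ne_zero.2 (by positivity)) (he0 i) h1.symm
  have hli : LinearIndependent 𝕜 (e k) :=
    linearIndependent_of_ne_zero_of_inner_eq_zero hek (horth k)
  refine ⟨Submodule.span 𝕜 (Set.range (e k)), by rw [finrank_span_eq_card hli, Fintype.card_fin],
    fun x hx => ?_⟩
  obtain ⟨c, rfl⟩ := (Submodule.mem_span_range_iff_exists_fun 𝕜).1 hx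
  have hJx : (integrationOp 𝕜 ^ k) (∑ i, c i • e k i) =
      ((n⁻¹ ^ k : ℝ) : 𝕜) • ∑ i, c i • e 0 i := by
    simp only [map_sum, map_smul, hJk, Finset.smul_sum]
    exact Finset.sum_congr rfl fun i _ => smul_comm _ _ _
  rw [hJx, norm_smul, RCLike.norm_ofReal, abs_of_nonneg (by positivity), mul_right_comm, mul_comm,
    one_div]
  refine mul_le_mul_of_nonneg_left ?_ (by positivity)
  rw [← sq_le_sq₀ (by positivity) (norm_nonneg _), mul_pow, Real.sq_sqrt (by positivity),
    norm_sum_smul_sq_of_pairwise (hnorm k) (horth k),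
    norm_sum_smul_sq_of_pairwise (hnorm 0) (horth 0), div_mul_eq_mul_div,
    div_le_iff₀ (by positivity)]
  have hs : 0 ≤ n⁻¹ * r 0 * ∑ i, ‖c i‖ ^ 2 := by positivity
  nlinarith

end Bumps

/-! ### Comparison of `A` with `J ^ k` -/

theorem not_finiteDimensional_L2Unit (𝕜 : Type*) [RCLike 𝕜] :
    ¬ FiniteDimensional 𝕜 (L2Unit 𝕜) := fun _ => by
  -- Only the dimensions of the bump spaces matter here, so `k = 0` will do.
  obtain ⟨_, -, h⟩ := exists_submodule_le_norm_integrationOp_pow 𝕜 0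
  obtain ⟨V, hV, -⟩ := h (Module.finrank 𝕜 (L2Unit 𝕜))
  have := V.finrank_le
  omega

theorem mainTheorem3 {𝕜 : Type*} [RCLike 𝕜]
    {X : Type*} [NormedAddCommGroup X] [InnerProductSpace 𝕜 X] [CompleteSpace X]
    {Y : Type*} [NormedAddCommGroup Y] [InnerProductSpace 𝕜 Y] [CompleteSpace Y]
    (hX : ¬ FiniteDimensional 𝕜 X) (hY : ¬ FiniteDimensional 𝕜 Y)
    (A : X →L[𝕜] Y) (hA : IsCompactOperator A) (hinj : Function.Injective A)
    (k : ℕ)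
    (hσ : ∃ c C : ℝ, 0 < c ∧ 0 < C ∧ ∀ n : ℕ, 1 ≤ n →
      c * (1 / (n : ℝ) ^ k) ≤ singularValue A n ∧
        singularValue A n ≤ C * (1 / (n : ℝ) ^ k)) :
    (∃ (S : L2Unit 𝕜 ≃ₗᵢ[𝕜] A.range.topologicalClosure) (T : X ≃L[𝕜] L2Unit 𝕜),
        ∀ x : X, A x = (S ((integrationOp 𝕜 ^ k) (T x)) : Y)) ∧
      (∃ (S : L2Unit 𝕜 ≃L[𝕜] A.range.topologicalClosure) (T : X ≃ₗᵢ[𝕜] L2Unit 𝕜),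
        ∀ x : X, A x = (S ((integrationOp 𝕜 ^ k) (T x)) : Y)) := by
  obtain ⟨c, C, hc, hC, hcC⟩ := hσ
  obtain ⟨b, hb⟩ := exists_isSingularBasis hX hA hinj
  have hpos : ∀ n, 0 < ‖A (b n)‖ := fun n => by
    rw [norm_pos_iff, Ne, map_eq_zero_iff A hinj]
    exact b.orthonormal.ne_zero n
  have hbound : ∀ n : ℕ, c * (1 / (n + 1) : ℝ) ^ k ≤ ‖A (b n)‖ ∧
      ‖A (b n)‖ ≤ C * (1 / (n + 1) : ℝ) ^ k := fun n => by
    have h := hcC (n + 1) (Nat.le_add_left 1 n)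
    rw [hb.singularValue_eq n (hpos n)] at h
    simpa only [one_div, inv_pow, Nat.cast_add, Nat.cast_one] using h
  -- For `k = 0` all singular values would be at least `c > 0`, contradicting compactness.
  rcases eq_or_ne k 0 with rfl | hk
  · have huniv : {n | c ≤ ‖A (b n)‖} = Set.univ :=
      Set.eq_univ_of_forall fun n => by simpa using (hbound n).1
    exact absurd (huniv ▸ hb.finite c hc) Set.infinite_univ
  obtain ⟨f, hf⟩ := exists_isSingularBasis (not_finiteDimensional_L2Unit 𝕜)
    (isCompactOperator_integrationOp_pow (𝕜 := 𝕜) hk) (integrationOp_pow_injective k)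
  obtain ⟨δ, hδ, hlow⟩ := exists_submodule_le_norm_integrationOp_pow 𝕜 k
  have hlow' : ∀ N : ℕ, δ * (1 / (N + 1) : ℝ) ^ k ≤ ‖(integrationOp 𝕜 ^ k) (f N)‖ := fun N => by
    obtain ⟨V, hV, hVJ⟩ := hlow N
    have : FiniteDimensional 𝕜 V := FiniteDimensional.of_finrank_pos (by omega)
    exact hf.le_norm_apply V (by omega) hVJ
  have hk' : (0 : ℝ) < k := by exact_mod_cast Nat.pos_of_ne_zero hk
  have hup : ∀ N : ℕ, ‖(integrationOp 𝕜 ^ k) (f N)‖ ≤ (2 * k : ℝ) ^ k * (1 / (N + 1) : ℝ) ^ k :=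
    fun N => by
      rw [← mul_pow, mul_one_div]
      exact norm_singular_integrationOp_pow_le hk hf N
  -- `m` is the lower constant for `A` over the upper one for `J ^ k`; `M` is the upper constant for
  -- `A` over the lower one, `δ`.
  refine exists_factorization hinj (integrationOp_pow_injective k)
    (denseRange_integrationOp_pow k) hb hf (m := c / (2 * k : ℝ) ^ k) (M := C / δ)
    (by positivity) (fun n => ?_) (fun n => ?_)
  · refine le_trans ?_ (hbound n).1
    rw [div_mul_eq_mul_div, div_le_iff₀ (by positivity), mul_assoc, mul_comm (_ ^ k) (_ ^ k)]
    have := hup n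
    gcongr
  · refine (hbound n).2.trans ?_
    rw [div_mul_eq_mul_div, le_div_iff₀ hδ, mul_assoc]
    have := hlow' n
    gcongr
    linarith
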